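/- Let $R$ be a commutative noetherian local ring with maximal ideal $\mathfrak m$, residue field $k=R/\mathfrak m$ and $\mathfrak m$-adic completion $\widehat R$. For an $R$-module $L$ and an integer $i\ge 0$, let $\mu^i_R(L)=\operatorname{length}_R\operatorname{Ext}^i_R(k,L)$ be the $i$th Bass number and $\beta_i^R(L)=\operatorname{length}_R\operatorname{Tor}_i^R(k,L)$ the $i$th Betti number of $L$. Let $A$ be an artinian $R$-module. Each element of $A$ is annihilated by a power of $\mathfrak m$, so $A$ is naturally an $\widehat R$-module: if $\mathfrak m^n x=0$ and $r_0\in R$ has the same image as $r\in\widehat R$ in $R/\mathfrak m^n$, then $rx=r_0x$. By functoriality in the first argument, $\operatorname{Ext}^i_R(A,L)$ is an $\widehat R$-module for every $R$-module $L$. Let $i\ge 0$ and let $L$ and $L'$ be $R$-modules. (a) If $\mu^i_R(L)$ is finite, then $\operatorname{Ext}^i_R(A,L)$ is a noetherian $\widehat R$-module. (b) If $\beta_i^R(L')$ is finite, then $\operatorname{Tor}_i^R(A,L')$ is an artinian $R$-module. -/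

import Mathlib

open CategoryTheory

universe u

section Torsion

variable {R : Type u} [CommRing R] (I : Ideal R)
variable (M : Type u) [AddCommGroup M] [Module R M]

/-- `M` is `I`-torsion: every element of `M` is annihilated by some power of `I`. -/
def IsAdicTorsion : Prop :=
  ∀ x : M, ∃ n : ℕ, ∀ a ∈ I ^ n, a • x = 0

variable {I M}

/-- The action of the `I`-adic completion on an `I`-torsion module: if `I ^ n` annihilates `x`
and `r₀ : R` represents the image of `r` in `R ⧸ I ^ n`, then `r` acts on `x` as `r₀` does.
By `completionSMul_eq` the choices of `n` and `r₀` do not matter. -/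
noncomputable def completionSMul (h : IsAdicTorsion I M) (r : AdicCompletion I R) (x : M) : M :=
  (Ideal.Quotient.mk_surjective (AdicCompletion.evalₐ I (h x).choose r)).choose • x

theorem exists_mk_eq_evalₐ (r : AdicCompletion I R) (n m : ℕ) :
    ∃ s : R, Ideal.Quotient.mk (I ^ n) s = AdicCompletion.evalₐ I n r ∧
      Ideal.Quotient.mk (I ^ m) s = AdicCompletion.evalₐ I m r := by
  obtain ⟨c, rfl⟩ := AdicCompletion.mk_surjective I R r
  refine ⟨c (max n m), ?_, ?_⟩
  · rw [AdicCompletion.evalₐ_mk]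
    exact AdicCompletion.Ideal.mk_eq_mk I (le_max_left n m) c
  · rw [AdicCompletion.evalₐ_mk]
    exact AdicCompletion.Ideal.mk_eq_mk I (le_max_right n m) c

theorem completionSMul_eq (h : IsAdicTorsion I M) (r : AdicCompletion I R) (x : M) (n : ℕ)
    (hn : ∀ a ∈ I ^ n, a • x = 0) (r₀ : R)
    (hr : Ideal.Quotient.mk (I ^ n) r₀ = AdicCompletion.evalₐ I n r) :
    completionSMul h r x = r₀ • x := by
  have hk := (h x).choose_spec
  have hs := (Ideal.Quotient.mk_surjective (AdicCompletion.evalₐ I (h x).choose r)).choose_spec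
  obtain ⟨s, h1, h2⟩ := exists_mk_eq_evalₐ r n (h x).choose
  have e1 := hn _ (Ideal.Quotient.eq.mp (h1.trans hr.symm))
  have e2 := hk _ (Ideal.Quotient.eq.mp (h2.trans hs.symm))
  rw [sub_smul, sub_eq_zero] at e1 e2
  exact e2.symm.trans e1

/-- The action of the `I`-adic completion on an `I`-torsion module, as a ring homomorphism to
the `R`-linear endomorphisms. -/
noncomputable def completionToEnd (h : IsAdicTorsion I M) :
    AdicCompletion I R →+* Module.End R M where
  toFun r :=
    { toFun := completionSMul h r
      map_add' := fun x y => by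
        obtain ⟨n, hn⟩ := h x
        obtain ⟨m, hm⟩ := h y
        obtain ⟨k, hk⟩ := h (x + y)
        obtain ⟨t, ht, ht'⟩ := exists_mk_eq_evalₐ r (max n m) k
        have hx : ∀ a ∈ I ^ (max n m), a • x = 0 := fun a ha =>
          hn a (Ideal.pow_le_pow_right (le_max_left n m) ha)
        have hy : ∀ a ∈ I ^ (max n m), a • y = 0 := fun a ha =>
          hm a (Ideal.pow_le_pow_right (le_max_right n m) ha)
        rw [completionSMul_eq h r (x + y) k hk t ht', completionSMul_eq h r x _ hx t ht,
          completionSMul_eq h r y _ hy t ht, smul_add]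
      map_smul' := fun c x => by
        obtain ⟨n, hn⟩ := h x
        obtain ⟨s, hs, -⟩ := exists_mk_eq_evalₐ r n n
        have hcx : ∀ a ∈ I ^ n, a • c • x = 0 := fun a ha => by
          rw [smul_comm, hn a ha, smul_zero]
        rw [completionSMul_eq h r x n hn s hs, completionSMul_eq h r (c • x) n hcx s hs,
          smul_comm, RingHom.id_apply] }
  map_one' := by
    ext x
    obtain ⟨n, hn⟩ := h x
    exact (completionSMul_eq h 1 x n hn 1 (by simp)).trans (one_smul R x)
  map_zero' := by
    ext x
    obtain ⟨n, hn⟩ := h x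
    exact (completionSMul_eq h 0 x n hn 0 (by simp)).trans (zero_smul R x)
  map_mul' r r' := by
    ext x
    obtain ⟨n, hn⟩ := h x
    obtain ⟨s, hs, -⟩ := exists_mk_eq_evalₐ r n n
    obtain ⟨s', hs', -⟩ := exists_mk_eq_evalₐ r' n n
    have hsx : ∀ a ∈ I ^ n, a • s' • x = 0 := fun a ha => by
      rw [smul_comm, hn a ha, smul_zero]
    change completionSMul h (r * r') x = completionSMul h r (completionSMul h r' x)
    rw [completionSMul_eq h r' x n hn s' hs', completionSMul_eq h r _ n hsx s hs,
      completionSMul_eq h (r * r') x n hn (s * s') (by rw [map_mul, map_mul, hs, hs']), mul_smul]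
  map_add' r r' := by
    ext x
    obtain ⟨n, hn⟩ := h x
    obtain ⟨s, hs, -⟩ := exists_mk_eq_evalₐ r n n
    obtain ⟨s', hs', -⟩ := exists_mk_eq_evalₐ r' n n
    change completionSMul h (r + r') x = completionSMul h r x + completionSMul h r' x
    rw [completionSMul_eq h r' x n hn s' hs', completionSMul_eq h r x n hn s hs,
      completionSMul_eq h (r + r') x n hn (s + s') (by rw [map_add, map_add, hs, hs']), add_smul]

/-- The action of the completion extends the action of `R`. -/
theorem completionToEnd_algebraMap (h : IsAdicTorsion I M) (a : R) :
    completionToEnd h (algebraMap R (AdicCompletion I R) a) = a • LinearMap.id := by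
  ext x
  obtain ⟨n, hn⟩ := h x
  exact completionSMul_eq h _ x n hn a (AlgHom.commutes (AdicCompletion.evalₐ I n) a).symm

end Torsion

/-- An artinian module over a noetherian local ring is torsion for the maximal ideal. -/
theorem isAdicTorsion_of_isArtinian (R : Type u) [CommRing R] [IsLocalRing R] [IsNoetherianRing R]
    (A : Type u) [AddCommGroup A] [Module R A] [IsArtinian R A] :
    IsAdicTorsion (IsLocalRing.maximalIdeal R) A := by
  intro x
  set m := IsLocalRing.maximalIdeal R
  let f : ℕ →o (Submodule R A)ᵒᵈ :=
    ⟨fun n => OrderDual.toDual ((m ^ n) • Submodule.span R {x}), fun a b hab =>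
      OrderDual.toDual_le_toDual.mpr (Submodule.smul_mono_left (Ideal.pow_le_pow_right hab))⟩
  obtain ⟨n, hn⟩ := IsArtinian.monotone_stabilizes f
  have h1 : (m ^ n) • Submodule.span R {x} = (m ^ (n + 1)) • Submodule.span R {x} :=
    hn (n + 1) (Nat.le_succ n)
  have h2 : (m ^ n) • Submodule.span R {x} = ⊥ := by
    refine Submodule.eq_bot_of_le_smul_of_le_jacobson_bot m _ ?_ ?_
      (IsLocalRing.maximalIdeal_le_jacobson ⊥)
    · exact Submodule.FG.smul (IsNoetherian.noetherian (m ^ n)) (Submodule.fg_span_singleton x)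
    · rw [← Submodule.mul_smul, ← pow_succ']
      exact h1.le
  refine ⟨n, fun a ha => ?_⟩
  have h3 : a • x ∈ (m ^ n) • Submodule.span R {x} :=
    Submodule.smul_mem_smul ha (Submodule.mem_span_singleton_self x)
  rw [h2] at h3
  exact (Submodule.mem_bot R).mp h3

section Modules

variable (R : Type u) [CommRing R]

/-- `Ext^i_R(M, N)`. -/
noncomputable abbrev ExtModule (i : ℕ) (M N : Type u) [AddCommGroup M] [Module R M]
    [AddCommGroup N] [Module R N] : Type u :=
  Abelian.Ext.{u} (ModuleCat.of R M) (ModuleCat.of R N) i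

/-- `Tor_i^R(M, N)`. -/
noncomputable abbrev TorModule (i : ℕ) (M N : Type u) [AddCommGroup M] [Module R M]
    [AddCommGroup N] [Module R N] : Type u :=
  ((Tor (ModuleCat.{u} R) i).obj (ModuleCat.of R M)).obj (ModuleCat.of R N)

/-- The `i`-th Bass number `μ^i_R(L)`, the length of `Ext^i_R(k, L)`. -/
noncomputable def bassNumber [IsLocalRing R] (i : ℕ) (L : Type u) [AddCommGroup L] [Module R L] :
    ℕ∞ :=
  Module.length R (ExtModule R i (IsLocalRing.ResidueField R) L)

/-- The `i`-th Betti number `β_i^R(L)`, the length of `Tor_i^R(k, L)`. -/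
noncomputable def bettiNumber [IsLocalRing R] (i : ℕ) (L : Type u) [AddCommGroup L] [Module R L] :
    ℕ∞ :=
  Module.length R (TorModule R i (IsLocalRing.ResidueField R) L)

variable {R}

/-- The module structure of `Ext^i_R(M, N)` over the `I`-adic completion of `R` when `M` is
`I`-torsion: an element `r` of the completion acts by `Ext^i_R(r, N)`, the map induced by
the endomorphism of `M` given by the action of `r`. -/
@[reducible]
noncomputable def completionModuleExt {I : Ideal R} (i : ℕ) {M : Type u} (N : Type u)
    [AddCommGroup M] [Module R M] [AddCommGroup N] [Module R N] (h : IsAdicTorsion I M) :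
    Module (AdicCompletion I R) (ExtModule R i M N) where
  smul r e := (Abelian.Ext.mk₀ (ModuleCat.ofHom (completionToEnd h r))).comp e (zero_add i)
  one_smul e := by
    change (Abelian.Ext.mk₀ (ModuleCat.ofHom (completionToEnd h 1))).comp e (zero_add i) = e
    rw [map_one]
    exact Abelian.Ext.mk₀_id_comp e
  mul_smul r s e := by
    change (Abelian.Ext.mk₀ (ModuleCat.ofHom (completionToEnd h (r * s)))).comp e (zero_add i) =
      (Abelian.Ext.mk₀ (ModuleCat.ofHom (completionToEnd h r))).comp
        ((Abelian.Ext.mk₀ (ModuleCat.ofHom (completionToEnd h s))).comp e (zero_add i)) (zero_add i)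
    rw [Abelian.Ext.mk₀_comp_mk₀_assoc, mul_comm, map_mul]
    rfl
  smul_zero r := Abelian.Ext.comp_zero _ _ _ _ _
  smul_add r e e' := Abelian.Ext.comp_add _ _ _ _
  add_smul r s e := by
    change (Abelian.Ext.mk₀ (ModuleCat.ofHom (completionToEnd h (r + s)))).comp e (zero_add i) =
      (Abelian.Ext.mk₀ (ModuleCat.ofHom (completionToEnd h r))).comp e (zero_add i) +
        (Abelian.Ext.mk₀ (ModuleCat.ofHom (completionToEnd h s))).comp e (zero_add i)
    rw [map_add, ← Abelian.Ext.add_comp, ← Abelian.Ext.mk₀_add]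
    rfl
  zero_smul e := by
    change (Abelian.Ext.mk₀ (ModuleCat.ofHom (completionToEnd h 0))).comp e (zero_add i) = 0
    rw [map_zero]
    have : ModuleCat.ofHom (0 : Module.End R M) = 0 := rfl
    rw [this, Abelian.Ext.mk₀_zero, Abelian.Ext.zero_comp]

/-- The action of the completion on `Ext^i_R(M, N)` extends the usual action of `R`. -/
theorem completionModuleExt_algebraMap_smul {I : Ideal R} (i : ℕ) {M : Type u} (N : Type u)
    [AddCommGroup M] [Module R M] [AddCommGroup N] [Module R N] (h : IsAdicTorsion I M)
    (a : R) (e : ExtModule R i M N) :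
    letI := completionModuleExt i N h
    algebraMap R (AdicCompletion I R) a • e = a • e := by
  change (Abelian.Ext.mk₀ (ModuleCat.ofHom (completionToEnd h (algebraMap R _ a)))).comp e
    (zero_add i) = a • e
  have : ModuleCat.ofHom (completionToEnd h (algebraMap R _ a)) = a • 𝟙 (ModuleCat.of R M) := by
    rw [completionToEnd_algebraMap]
    rfl
  rw [this, Abelian.Ext.mk₀_smul, Abelian.Ext.smul_comp, Abelian.Ext.mk₀_id_comp]

end Modules

/-! ### Adic completions: noetherianity and a complete Nakayama lemma. -/

section Completion

variable {R : Type*} [CommRing R] (I : Ideal R)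

/-! Both halves reduce the artinian module A to finite data over k, with m-torsion of A in place of
finite generation.

For Ext, embed L essentially in an injective J; then J has the same socle as L. If Hom(k, L) has
finite length, this socle is noetherian. Restriction to socles sends Hom(A, J) to Hom(soc A, soc J),
which is noetherian, and its kernel lies in m Hom(A, J) because J is injective
(`mem_smul_top_of_forall_torsionBySet`). As A is m-torsion, Hom(A, J) is m-adically separated, so it
is finite over the noetherian completion (`finite_adicCompletion_of_isHausdorff`), and it contains a
copy of Hom(A, L). Higher degrees follow by dimension shifting along L → J → J/L in
`isNoetherian_ext`: essentiality makes the connecting map on Ext(k, -) injective even in degree 0,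
so finiteness passes to J/L.

For Tor, resolve L' by projectives and split the degree i term F₀ modulo m into boundaries, finitely
many further cycle representatives, and a complement G on which the differential is split injective
(`exists_free_generators_of_residueField_homology`). Both the generation and the injectivity survive
tensoring with the m-torsion module A. A homology class is then represented by an element of A^s ⊕
(A ⊗ G) whose second coordinate is determined by the first, so Tor is a quotient of a submodule of
A^s. -/

variable {I} in
/-- The ring homomorphism `P^ → R ⧸ I ^ n` induced by a ring homomorphism `f : P → R` with
`f J ⊆ I`, where `P^` is the `J`-adic completion. -/
noncomputable def adicCompletionToQuotient {P : Type*} [CommRing P] {J : Ideal P} {f : P →+* R}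
    (h : J ≤ I.comap f) (n : ℕ) : AdicCompletion J P →+* R ⧸ I ^ n :=
  (Ideal.quotientMap (I ^ n) f ((Ideal.pow_right_mono h n).trans (Ideal.le_comap_pow f n))).comp
    (AdicCompletion.evalₐ J n : AdicCompletion J P →+* P ⧸ J ^ n)

variable {I} in
theorem factorPow_comp_adicCompletionToQuotient {P : Type*} [CommRing P] {J : Ideal P}
    {f : P →+* R} (h : J ≤ I.comap f) {m n : ℕ} (hle : m ≤ n) :
    (Ideal.Quotient.factorPow I hle).comp (adicCompletionToQuotient h n) =
      adicCompletionToQuotient h m := by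
  ext x
  obtain ⟨c, rfl⟩ := AdicCompletion.mk_surjective J P x
  have := (AdicCompletion.Ideal.mk_eq_mk J hle c).symm
  simp only [adicCompletionToQuotient, RingHom.comp_apply, RingHom.coe_coe,
    AdicCompletion.evalₐ_mk]
  rw [this]
  rfl

/-- The ring homomorphism between adic completions induced by a ring homomorphism `f` with
`f J ⊆ I`. -/
noncomputable def adicCompletionMapRingHom {P : Type*} [CommRing P] (J : Ideal P) (f : P →+* R)
    (h : J ≤ I.comap f) : AdicCompletion J P →+* AdicCompletion I R :=
  AdicCompletion.liftRingHom I (adicCompletionToQuotient h)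
    (factorPow_comp_adicCompletionToQuotient h)

theorem adicCompletionMapRingHom_algebraMap {P : Type*} [CommRing P] (J : Ideal P) (f : P →+* R)
    (h : J ≤ I.comap f) (p : P) :
    adicCompletionMapRingHom I J f h (algebraMap P _ p) = algebraMap R _ (f p) := by
  apply AdicCompletion.ext_evalₐ
  intro n
  rw [AlgHom.commutes]
  refine (AdicCompletion.evalₐ_liftRingHom I _
    (factorPow_comp_adicCompletionToQuotient h) n _).trans ?_
  rw [adicCompletionToQuotient, RingHom.comp_apply, RingHom.coe_coe, AlgHom.commutes]
  rfl

variable {I}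

/-- The source is complete and the target separated for the extended ideals, so it suffices to hit
every class modulo I, where `f` already does. -/
theorem adicCompletionMapRingHom_surjective {P : Type*} [CommRing P] {J : Ideal P} {f : P →+* R}
    (h : J.map f = I) (hf : Function.Surjective f) (hJ : J.FG) :
    Function.Surjective (adicCompletionMapRingHom I J f (Ideal.map_le_iff_le_comap.mp h.le)) := by
  have hI : I.FG := h ▸ hJ.map f
  have := AdicCompletion.isAdicComplete_self J hJ
  have := AdicCompletion.isAdicComplete_self I hI
  set g := adicCompletionMapRingHom I J f (Ideal.map_le_iff_le_comap.mp h.le)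
  have hmap : (J.map (algebraMap P (AdicCompletion J P))).map g =
      I.map (algebraMap R (AdicCompletion I R)) := by
    have hg : g.comp (algebraMap P (AdicCompletion J P)) =
        (algebraMap R (AdicCompletion I R)).comp f :=
      RingHom.ext (adicCompletionMapRingHom_algebraMap I J f (Ideal.map_le_iff_le_comap.mp h.le))
    rw [Ideal.map_map, hg, ← Ideal.map_map, h]
  have : IsHausdorff ((J.map (algebraMap P (AdicCompletion J P))).map g)
      (AdicCompletion I R) := by
    rw [hmap]; infer_instance
  refine surjective_of_mk_map_comp_surjective (I := J.map (algebraMap P (AdicCompletion J P))) g ?_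
  intro y
  obtain ⟨y, rfl⟩ := Ideal.Quotient.mk_surjective y
  obtain ⟨r, hr⟩ := Ideal.Quotient.mk_surjective (AdicCompletion.evalOneₐ I y)
  obtain ⟨p, rfl⟩ := hf r
  refine ⟨algebraMap P _ p, ?_⟩
  rw [RingHom.comp_apply, adicCompletionMapRingHom_algebraMap, Ideal.Quotient.eq, hmap,
    ← AdicCompletion.ker_evalOneₐ_eq_map I hI, RingHom.mem_ker]
  have : AdicCompletion.evalOneₐ I (algebraMap R _ (f p)) = Ideal.Quotient.mk I (f p) :=
    AlgHom.commutes _ _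
  change AdicCompletion.evalOneₐ I _ = 0
  rw [map_sub, this, hr, sub_self]

/-- The adic completion of a noetherian ring is noetherian. -/
theorem isNoetherianRing_adicCompletion [IsNoetherianRing R] :
    IsNoetherianRing (AdicCompletion I R) := by
  obtain ⟨n, x, hx⟩ := Submodule.fg_iff_exists_fin_generating_family.mp
    (IsNoetherian.noetherian I)
  -- Variables go to generators of I. The completion of R[X] at (X) is the noetherian ring R[[X]],
  -- and it maps onto the completion of R.
  let f : MvPolynomial (Fin n) R →+* R := (MvPolynomial.aeval x).toRingHom
  have hf : Function.Surjective f := fun r => ⟨MvPolynomial.C r, by simp [f]⟩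
  have hmap : (MvPolynomial.idealOfVars (Fin n) R).map f = I := by
    rw [MvPolynomial.idealOfVars, Ideal.map_span, ← Set.range_comp, ← hx]
    have : f ∘ MvPolynomial.X = x := by ext; simp [f]
    rw [this]
  have := isNoetherianRing_of_ringEquiv _
    (MvPowerSeries.toAdicCompletionAlgEquiv (Fin n) R).toRingEquiv
  exact isNoetherianRing_of_surjective _ _ _
    (adicCompletionMapRingHom_surjective hmap hf (MvPolynomial.idealOfVars_fg _ _))

/-- A separated module over the adic completion that is finitely generated modulo `I` is finitely
generated. -/
theorem finite_adicCompletion_of_isHausdorff {H : Type*} [AddCommGroup H] [Module R H]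
    [Module (AdicCompletion I R) H] [IsScalarTower R (AdicCompletion I R) H] (hI : I.FG)
    [IsHausdorff I H] {s : ℕ} (b : Fin s → H)
    (hb : Submodule.span R (Set.range b) ⊔ I • ⊤ = ⊤) : Module.Finite (AdicCompletion I R) H := by
  let φ : (Fin s → AdicCompletion I R) →ₗ[AdicCompletion I R] H := Fintype.linearCombination _ b
  -- Seen as a map from the I-complete module (R^s)^ to the I-separated module `H`, it is surjective
  -- once it is so modulo I.
  let ψ : AdicCompletion I (Fin s → R) →ₗ[AdicCompletion I R] H :=
    φ ∘ₗ (AdicCompletion.piEquivFin I s).toLinearMap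
  have := AdicCompletion.isAdicComplete (M := Fin s → R) hI
  refine Module.Finite.of_surjective φ ?_
  suffices h : Function.Surjective (ψ.restrictScalars R) by
    intro y
    obtain ⟨x, hx⟩ := h y
    exact ⟨_, hx⟩
  refine surjective_of_mkQ_comp_surjective (I := I) ?_
  intro y
  obtain ⟨y, rfl⟩ := Submodule.mkQ_surjective _ y
  obtain ⟨z, hz, w, hw, rfl⟩ := Submodule.mem_sup.mp (hb ▸ Submodule.mem_top : y ∈ _)
  rw [← Fintype.range_linearCombination R b] at hz
  obtain ⟨c, rfl⟩ := hz
  refine ⟨(AdicCompletion.piEquivFin I s).symm (fun j => algebraMap R _ (c j)), ?_⟩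
  have h1 : ψ ((AdicCompletion.piEquivFin I s).symm (fun j => algebraMap R _ (c j))) =
      Fintype.linearCombination R b c := by
    simp [ψ, φ, Fintype.linearCombination_apply]
  rw [LinearMap.comp_apply, LinearMap.restrictScalars_apply, h1, map_add,
    show (I • ⊤ : Submodule R H).mkQ w = 0 from (Submodule.Quotient.mk_eq_zero _).mpr hw, add_zero]

end Completion

/-! ### Essential extensions and injective hulls. -/

section Essential

variable {R : Type*} [Ring R] {E : Type*} [AddCommGroup E] [Module R E]

/-- `J` is an essential extension of `L` inside `E`: it contains `L`, and every nonzero submodule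
of `J` meets `L`. -/
def IsEssentialExtension (L J : Submodule R E) : Prop :=
  L ≤ J ∧ ∀ N ≤ J, N ⊓ L = ⊥ → N = ⊥

/-- Zorn applies because essentiality can be tested on cyclic submodules, and each of these lies in
a single member of a chain. -/
theorem exists_maximal_isEssentialExtension (L : Submodule R E) :
    ∃ J, Maximal (IsEssentialExtension L) J := by
  refine (zorn_le_nonempty₀ {J | IsEssentialExtension L J} (fun c hc hchain y hy => ?_) L
    ⟨le_rfl, fun N hN h => by rwa [inf_eq_left.mpr hN] at h⟩).imp fun J hJ => hJ.2
  refine ⟨sSup c, ⟨(hc hy).1.trans (le_sSup hy), fun N hN h => ?_⟩, fun z hz => le_sSup hz⟩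
  rw [Submodule.eq_bot_iff]
  intro x hx
  obtain ⟨J, hJ, hxJ⟩ := (Submodule.mem_sSup_of_directed ⟨y, hy⟩ hchain.directedOn).mp (hN hx)
  have := (hc hJ).2 (Submodule.span R {x}) (by simpa using hxJ)
    (eq_bot_iff.mpr ((inf_le_inf_right L (by simpa using hx)).trans h.le))
  simpa using this

theorem exists_maximal_inf_eq_bot (J : Submodule R E) :
    ∃ K, Maximal (fun K : Submodule R E => K ⊓ J = ⊥) K := by
  refine (zorn_le_nonempty₀ {K : Submodule R E | K ⊓ J = ⊥} (fun c hc hchain y hy => ?_) ⊥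
    (bot_inf_eq J)).imp fun K hK => hK.2
  refine ⟨sSup c, ?_, fun z hz => le_sSup hz⟩
  rw [Set.mem_ofPred_eq, Submodule.eq_bot_iff]
  rintro x ⟨hx, hxJ⟩
  obtain ⟨K, hK, hxK⟩ := (Submodule.mem_sSup_of_directed ⟨y, hy⟩ hchain.directedOn).mp hx
  exact (Submodule.eq_bot_iff _).mp (hc hK) x ⟨hxK, hxJ⟩

end Essential

section InjectiveHull

variable {R : Type u} [Ring R] {E : Type u} [AddCommGroup E] [Module R E]

/-- A maximal essential extension inside an injective module is a direct summand. -/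
theorem exists_retraction_of_maximal_isEssentialExtension [Module.Injective R E]
    {L J : Submodule R E} (hJ : Maximal (IsEssentialExtension L) J) :
    ∃ p : E →ₗ[R] J, ∀ x : J, p x = x := by
  obtain ⟨K, hKJ, hK⟩ := exists_maximal_inf_eq_bot J
  -- J embeds in E/K, so its inclusion into E extends to E/K; this gives an endomorphism `q` of E
  -- that fixes J and kills K.
  obtain ⟨g, hg⟩ := Module.Injective.out (K.mkQ ∘ₗ J.subtype) (by
    rw [← LinearMap.ker_eq_bot, LinearMap.ker_comp, Submodule.ker_mkQ, Submodule.eq_bot_iff]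
    intro x hx
    exact Subtype.ext ((Submodule.eq_bot_iff _).mp hKJ x ⟨hx, x.2⟩)) J.subtype
  let q : E →ₗ[R] E := g ∘ₗ K.mkQ
  have hq : ∀ x ∈ J, q x = x := fun x hx => hg ⟨x, hx⟩
  have hKq : ∀ x ∈ K, q x = 0 := fun x hx => by
    change g (K.mkQ x) = 0
    rw [show K.mkQ x = 0 from (Submodule.Quotient.mk_eq_zero _).mpr hx, map_zero]
  -- The preimage of N under `q` contains K and still avoids J, so it equals K by maximality of K.
  have key : ∀ N : Submodule R E, N ⊓ J = ⊥ → ∀ x, q x ∈ N → q x = 0 := by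
    intro N hN x hx
    refine hKq x (hK (y := N.comap q) ?_ (fun y hy => ?_) hx)
    · refine (Submodule.eq_bot_iff _).mpr ?_
      rintro y ⟨hy, hyJ⟩
      refine (Submodule.eq_bot_iff _).mp hN y ⟨?_, hyJ⟩
      simpa [hq y hyJ] using hy
    · rw [Submodule.mem_comap, hKq y hy]
      exact N.zero_mem
  -- By `key`, the image of `q` is an essential extension of J, hence of L; maximality of J forces
  -- it into J.
  have hrange : LinearMap.range q ≤ J := by
    refine hJ.2 ⟨fun x hx => ⟨x, hq x (hJ.1.1 hx)⟩, fun N hN h => ?_⟩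
      (fun x hx => ⟨x, hq x hx⟩)
    have hNJ : N ⊓ J = ⊥ := hJ.1.2 _ inf_le_right
      (eq_bot_iff.mpr ((inf_le_inf_right L inf_le_left).trans h.le))
    rw [Submodule.eq_bot_iff]
    intro y hy
    obtain ⟨x, rfl⟩ := hN hy
    exact key N hNJ x hy
  exact ⟨q.codRestrict J fun x => hrange ⟨x, rfl⟩, fun x => Subtype.ext (hq x x.2)⟩

end InjectiveHull

/-- Every module embeds in an injective module as an essential submodule. -/
theorem exists_injective_essential_embedding (R : Type u) [CommRing R] (L : Type u)
    [AddCommGroup L] [Module R L] :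
    ∃ J : ModuleCat.{u} R, Module.Injective R J ∧ ∃ f : L →ₗ[R] J, Function.Injective f ∧
      ∀ N : Submodule R J, N ⊓ LinearMap.range f = ⊥ → N = ⊥ := by
  obtain ⟨⟨E, hE, i, hi⟩⟩ := EnoughInjectives.presentation (ModuleCat.of R L)
  have hE' : Module.Injective R E := (Module.injective_iff_injective_object R E).mpr hE
  have hinj : Function.Injective i.hom := (ModuleCat.mono_iff_injective i).mp hi
  obtain ⟨J, hJ⟩ := exists_maximal_isEssentialExtension (LinearMap.range i.hom)
  obtain ⟨p, hp⟩ := exists_retraction_of_maximal_isEssentialExtension hJ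
  refine ⟨ModuleCat.of R J, ⟨fun X Y _ _ _ _ f hf g => ?_⟩,
    i.hom.codRestrict J fun x => hJ.1.1 ⟨x, rfl⟩, fun x y h => hinj (congrArg Subtype.val h),
    fun N hN => ?_⟩
  -- A retract of an injective module is injective.
  · obtain ⟨h, hh⟩ := hE'.out f hf (J.subtype ∘ₗ g)
    exact ⟨p ∘ₗ h, fun x => by simp [hh, hp]⟩
  · have := hJ.1.2 (N.map J.subtype) (Submodule.map_subtype_le _ _) (by
      rw [Submodule.eq_bot_iff]
      rintro _ ⟨⟨y, hy, rfl⟩, ⟨x, hx⟩⟩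
      have := (Submodule.eq_bot_iff _).mp hN y ⟨hy, ⟨x, Subtype.ext hx⟩⟩
      simp [this])
    exact Submodule.map_injective_of_injective J.injective_subtype
      (this.trans (Submodule.map_bot _).symm)

/-! ### Socles over a local ring. -/

section Socle

variable (R : Type*) [CommRing R] [IsLocalRing R] (M : Type*) [AddCommGroup M] [Module R M]

/-- The socle of a module over a local ring: the elements annihilated by the maximal ideal. -/
abbrev moduleSocle : Submodule R M :=
  Submodule.torsionBySet R M (IsLocalRing.maximalIdeal R : Set R)

variable {R M}

theorem smul_eq_zero_of_mem_moduleSocle {x : M} (hx : x ∈ moduleSocle R M) {a : R}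
    (ha : a ∈ IsLocalRing.maximalIdeal R) : a • x = 0 :=
  (Submodule.mem_torsionBySet_iff _ _).mp hx ⟨a, ha⟩

theorem mem_moduleSocle_of_forall {x : M}
    (h : ∀ a ∈ IsLocalRing.maximalIdeal R, a • x = 0) : x ∈ moduleSocle R M :=
  (Submodule.mem_torsionBySet_iff _ _).mpr fun a => h a a.2

/-- Such a module is a vector space over the residue field, hence semisimple, and there the two
chain conditions agree. -/
theorem isNoetherian_of_isArtinian_of_isTorsionBySet [IsArtinian R M]
    (h : Module.IsTorsionBySet R M (IsLocalRing.maximalIdeal R : Set R)) : IsNoetherian R M := by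
  let := h.module
  let : Field (R ⧸ IsLocalRing.maximalIdeal R) := Ideal.Quotient.field _
  have : IsSemisimpleModule R M := h.isSemisimpleModule_iff.mp inferInstance
  exact ((IsSemisimpleModule.finite_tfae (R := R) (M := M)).out 2 1).mp ‹_›

instance isNoetherian_moduleSocle [IsArtinian R M] : IsNoetherian R (moduleSocle R M) :=
  isNoetherian_of_isArtinian_of_isTorsionBySet (Submodule.torsionBySet_isTorsionBySet _)

/-- An essential submodule contains the socle. -/
theorem moduleSocle_le_of_essential {L : Submodule R M}
    (h : ∀ N : Submodule R M, N ⊓ L = ⊥ → N = ⊥) : moduleSocle R M ≤ L := by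
  intro x hx
  by_contra hxL
  -- A multiple of x is zero or a unit multiple, and a unit multiple in L would put x in L.
  have hbot : Submodule.span R {x} ⊓ L = ⊥ := by
    rw [Submodule.eq_bot_iff]
    rintro y ⟨hy, hyL⟩
    obtain ⟨r, rfl⟩ := Submodule.mem_span_singleton.mp hy
    by_cases hr : r ∈ IsLocalRing.maximalIdeal R
    · exact smul_eq_zero_of_mem_moduleSocle hx hr
    · have hu : IsUnit r := by simpa using hr
      exact absurd ((Submodule.smul_mem_iff_of_isUnit L hu).mp hyL) hxL
  have hx0 : x = 0 := by simpa using h _ hbot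
  exact hxL (hx0 ▸ L.zero_mem)

/-- Sending x to the map 1 ↦ x embeds the socle in Hom(k, M). -/
theorem isNoetherian_moduleSocle_of_residueField_hom
    [IsNoetherian R (IsLocalRing.ResidueField R →ₗ[R] M)] : IsNoetherian R (moduleSocle R M) := by
  let φ : moduleSocle R M →ₗ[R] (IsLocalRing.ResidueField R →ₗ[R] M) :=
    { toFun x := (IsLocalRing.maximalIdeal R).liftQ (LinearMap.toSpanSingleton R M x)
        fun a ha => smul_eq_zero_of_mem_moduleSocle x.2 ha
      map_add' x y := by
        ext a
        obtain ⟨a, rfl⟩ := Submodule.Quotient.mk_surjective _ a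
        exact smul_add a (x : M) y
      map_smul' r x := by
        ext a
        obtain ⟨a, rfl⟩ := Submodule.Quotient.mk_surjective _ a
        exact smul_comm a r (x : M) }
  refine isNoetherian_of_injective φ ?_
  intro x y h
  have h1 : (1 : R) • (x : M) = (1 : R) • (y : M) :=
    LinearMap.congr_fun h (Submodule.Quotient.mk 1)
  exact Subtype.ext (by rwa [one_smul, one_smul] at h1)

/-- An essential extension creates no new socle elements: those of J come from the socle of M. -/
theorem isNoetherian_moduleSocle_of_essential {J : Type*} [AddCommGroup J] [Module R J]
    [IsNoetherian R (moduleSocle R M)] {f : M →ₗ[R] J} (hf : Function.Injective f)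
    (h : ∀ N : Submodule R J, N ⊓ LinearMap.range f = ⊥ → N = ⊥) :
    IsNoetherian R (moduleSocle R J) := by
  have hle : moduleSocle R J ≤ (moduleSocle R M).map f := by
    intro x hx
    obtain ⟨y, rfl⟩ := moduleSocle_le_of_essential h hx
    refine ⟨y, mem_moduleSocle_of_forall fun a ha => hf ?_, rfl⟩
    rw [map_smul, map_zero, smul_eq_zero_of_mem_moduleSocle hx ha]
  have : IsNoetherian R ((moduleSocle R M).map f) :=
    isNoetherian_of_surjective (f.submoduleMap _)
      (LinearMap.range_eq_top.mpr (f.submoduleMap_surjective _))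
  exact isNoetherian_of_le hle

end Socle

/-! ### Homomorphisms from an artinian module to an injective module. -/

section Hom

variable {R : Type u} [CommRing R] {A : Type u} [AddCommGroup A] [Module R A]
  {J : Type u} [AddCommGroup J] [Module R J]

/-- A map in I^n Hom(A, J) vanishes on every element killed by I^n, and such elements exhaust A. -/
theorem isHausdorff_linearMap_of_isAdicTorsion {I : Ideal R} (hA : IsAdicTorsion I A) :
    IsHausdorff I (A →ₗ[R] J) := by
  refine ⟨fun h hh => LinearMap.ext fun x => ?_⟩
  obtain ⟨n, hn⟩ := hA x
  have hmem := SModEq.zero.mp (hh n)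
  refine Submodule.smul_induction_on (p := fun g => g x = 0) hmem (fun a ha g _ => ?_)
    (fun g g' hg hg' => ?_)
  · rw [LinearMap.smul_apply, ← map_smul, hn a ha, map_zero]
  · rw [LinearMap.add_apply, hg, hg', add_zero]

/-- A homomorphism to an injective module that vanishes on the elements annihilated by a finitely
generated ideal `I` lies in `I • Hom(A, J)`. -/
theorem mem_smul_top_of_forall_torsionBySet [Module.Injective R J] {I : Ideal R} (hI : I.FG)
    (h : A →ₗ[R] J) (hh : ∀ x ∈ Submodule.torsionBySet R A (I : Set R), h x = 0) :
    h ∈ (I • ⊤ : Submodule R (A →ₗ[R] J)) := by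
  obtain ⟨n, x, hx⟩ := Submodule.fg_iff_exists_fin_generating_family.mp hI
  -- The kernel of a ↦ (x₁a, …, xₙa) is the I-torsion of A, so `h` factors through the image.
  -- Extending that factor to `g` on A^n gives h = ∑ xⱼ gⱼ with gⱼ the components of `g`.
  let α : A →ₗ[R] (Fin n → A) := LinearMap.pi fun j => x j • LinearMap.id
  have hker : LinearMap.ker α ≤ LinearMap.ker h := by
    intro a ha
    refine hh a ?_
    rw [← hx]
    change a ∈ Submodule.torsionBySet R A (Ideal.span (Set.range x) : Set R)
    rw [← Submodule.torsionBySet_eq_torsionBySet_span, Submodule.mem_torsionBySet_iff]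
    rintro ⟨_, j, rfl⟩
    exact congrFun ha j
  obtain ⟨g, hg⟩ := Module.Injective.out (LinearMap.range α).subtype
    (Submodule.injective_subtype _)
    ((LinearMap.ker α).liftQ h hker ∘ₗ α.quotKerEquivRange.symm.toLinearMap)
  have key : h = ∑ j, x j • (g ∘ₗ LinearMap.single R (fun _ => A) j) := by
    ext a
    have h1 : h a = g (α a) := by
      have := hg ⟨α a, a, rfl⟩
      have h2 : α.quotKerEquivRange.symm ⟨α a, a, rfl⟩ = Submodule.Quotient.mk a :=
        (LinearEquiv.symm_apply_eq _).mpr rfl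
      simpa [h2] using this.symm
    have h3 : α a = ∑ j, Pi.single j (x j • a) := by
      rw [Finset.univ_sum_single (fun j => x j • a)]
      rfl
    rw [h1, h3, map_sum, LinearMap.sum_apply]
    refine Finset.sum_congr rfl fun j _ => ?_
    rw [LinearMap.smul_apply, LinearMap.comp_apply, ← map_smul, ← map_smul]
    rfl
  rw [key]
  exact Submodule.sum_mem _ fun j _ => Submodule.smul_mem_smul
    (hx ▸ Submodule.subset_span ⟨j, rfl⟩) Submodule.mem_top

/-- Maps A → J restrict to maps between the noetherian socles. Lifts of generators of the image
suffice, since a map vanishing on soc A lies in m Hom(A, J). -/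
theorem exists_span_sup_smul_top_eq_top [IsLocalRing R] [IsNoetherianRing R] [IsArtinian R A]
    [Module.Injective R J] [IsNoetherian R (moduleSocle R J)] :
    ∃ (s : ℕ) (b : Fin s → (A →ₗ[R] J)),
      Submodule.span R (Set.range b) ⊔ IsLocalRing.maximalIdeal R • ⊤ = ⊤ := by
  let ρ : (A →ₗ[R] J) →ₗ[R] (moduleSocle R A →ₗ[R] moduleSocle R J) :=
    { toFun h := (h ∘ₗ (moduleSocle R A).subtype).codRestrict _ fun x =>
        mem_moduleSocle_of_forall fun a ha => by
          rw [← map_smul, Subtype.ext (smul_eq_zero_of_mem_moduleSocle x.2 ha) (a1 := a • x)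
            (a2 := 0), map_zero]
      map_add' h h' := rfl
      map_smul' r h := rfl }
  obtain ⟨s, c, hc⟩ := Submodule.fg_iff_exists_fin_generating_family.mp
    (IsNoetherian.noetherian (LinearMap.range ρ))
  have hmem : ∀ j, c j ∈ LinearMap.range ρ := fun j => hc ▸ Submodule.subset_span ⟨j, rfl⟩
  choose b hb using hmem
  refine ⟨s, b, eq_top_iff.mpr fun h _ => ?_⟩
  have hspan : (Submodule.span R (Set.range b)).map ρ = LinearMap.range ρ := by
    rw [Submodule.map_span, ← Set.range_comp, ← hc]
    congr 2
    exact funext hb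
  obtain ⟨z, hz, hzh⟩ : ρ h ∈ (Submodule.span R (Set.range b)).map ρ := hspan ▸ ⟨h, rfl⟩
  refine Submodule.mem_sup.mpr ⟨z, hz, h - z, ?_, by abel⟩
  refine mem_smul_top_of_forall_torsionBySet (IsNoetherian.noetherian _) _ fun x hx => ?_
  have := congrArg Subtype.val (LinearMap.congr_fun hzh ⟨x, hx⟩)
  rw [LinearMap.sub_apply, sub_eq_zero]
  exact this.symm

end Hom

/-! ### Ext as a module over the completion, and its noetherianity. -/

section ExtCompletion

variable {R : Type u} [CommRing R] {I : Ideal R} {M : Type u} [AddCommGroup M] [Module R M]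
  (hM : IsAdicTorsion I M)

/-- Composition with an extension class is linear over the completion. -/
noncomputable def completionExtPostcomp {N N' : Type u} [AddCommGroup N] [Module R N]
    [AddCommGroup N'] [Module R N'] {i a j : ℕ} (e : ExtModule R a N N') (hj : i + a = j) :
    let := completionModuleExt i N hM
    let := completionModuleExt j N' hM
    ExtModule R i M N →ₗ[AdicCompletion I R] ExtModule R j M N' :=
  let := completionModuleExt i N hM
  let := completionModuleExt j N' hM
  { toFun x := x.comp e hj
    map_add' x y := Abelian.Ext.add_comp _ _ _ _
    -- The completion acts by composition on the A side, which commutes with composition on the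
    -- other side by associativity.
    map_smul' r x := Abelian.Ext.comp_assoc _ _ _ (zero_add i) hj (by omega) }

theorem isScalarTower_completionModuleExt (i : ℕ) (N : Type u) [AddCommGroup N] [Module R N] :
    let := completionModuleExt i N hM
    IsScalarTower R (AdicCompletion I R) (ExtModule R i M N) := by
  let := completionModuleExt i N hM
  refine ⟨fun a r e => ?_⟩
  rw [Algebra.smul_def, mul_smul]
  exact completionModuleExt_algebraMap_smul i N hM a _

end ExtCompletion

section ExtArtinian

variable {R : Type u} [CommRing R]

/-- `Ext^0_R(M, N)` is `Hom_R(M, N)`. -/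
noncomputable def extZeroLinearEquiv (M N : Type u) [AddCommGroup M] [Module R M]
    [AddCommGroup N] [Module R N] : ExtModule R 0 M N ≃ₗ[R] (M →ₗ[R] N) :=
  (Abelian.Ext.linearEquiv₀ (R := R)).trans ModuleCat.homLinearEquiv

variable [IsLocalRing R] [IsNoetherianRing R] {A : Type u} [AddCommGroup A] [Module R A]
  [IsArtinian R A]

theorem isNoetherian_ext_zero_of_injective (J : Type u) [AddCommGroup J] [Module R J]
    [Module.Injective R J] [IsNoetherian R (moduleSocle R J)] :
    letI := completionModuleExt 0 J (isAdicTorsion_of_isArtinian R A)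
    IsNoetherian (AdicCompletion (IsLocalRing.maximalIdeal R) R) (ExtModule R 0 A J) := by
  have hA := isAdicTorsion_of_isArtinian R A
  let := completionModuleExt 0 J hA
  have := isScalarTower_completionModuleExt hA 0 J
  let e := extZeroLinearEquiv (R := R) A J
  have hmap : ∀ I : Ideal R, (I • ⊤ : Submodule R (ExtModule R 0 A J)).map e.toLinearMap =
      (I • ⊤ : Submodule R (A →ₗ[R] J)) := fun I => by
    rw [Submodule.map_smul'', Submodule.map_top, LinearEquiv.range]
  have : IsHausdorff (IsLocalRing.maximalIdeal R) (ExtModule R 0 A J) := by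
    refine ⟨fun x hx => e.injective ?_⟩
    rw [map_zero]
    refine (isHausdorff_linearMap_of_isAdicTorsion (J := J) hA).haus _ fun n => ?_
    rw [SModEq.zero, ← hmap]
    exact ⟨x, SModEq.zero.mp (hx n), rfl⟩
  obtain ⟨s, b, hb⟩ := exists_span_sup_smul_top_eq_top (R := R) (A := A) (J := J)
  have hfin : Module.Finite (AdicCompletion (IsLocalRing.maximalIdeal R) R)
      (ExtModule R 0 A J) := by
    refine finite_adicCompletion_of_isHausdorff (IsNoetherian.noetherian _)
      (fun j => e.symm (b j)) ?_
    refine Submodule.map_injective_of_injective e.injective ?_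
    rw [Submodule.map_sup, hmap, Submodule.map_span, ← Set.range_comp, Submodule.map_top,
      LinearEquiv.range, ← hb]
    congr 3
    ext1 j
    simp
  have := isNoetherianRing_adicCompletion (I := IsLocalRing.maximalIdeal R)
  exact isNoetherian_of_isNoetherianRing_of_finite _ _

/-- Dimension shifting by induction on i, for all L at once. The cokernel J/L inherits the
finiteness hypothesis through an injective connecting map for k, and transmits the conclusion
through a surjective one for A. -/
theorem isNoetherian_ext (i : ℕ) (L : Type u) [AddCommGroup L] [Module R L]
    (hL : IsFiniteLength R (ExtModule R i (IsLocalRing.ResidueField R) L)) :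
    letI := completionModuleExt i L (isAdicTorsion_of_isArtinian R A)
    IsNoetherian (AdicCompletion (IsLocalRing.maximalIdeal R) R) (ExtModule R i A L) := by
  have hA := isAdicTorsion_of_isArtinian R A
  induction i generalizing L with
  | zero =>
    obtain ⟨J, hJ, f, hf, hess⟩ := exists_injective_essential_embedding R L
    have h1 := (isFiniteLength_iff_isNoetherian_isArtinian.mp hL).1
    have : IsNoetherian R (IsLocalRing.ResidueField R →ₗ[R] L) :=
      isNoetherian_of_linearEquiv (extZeroLinearEquiv (IsLocalRing.ResidueField R) L)
    have := isNoetherian_moduleSocle_of_residueField_hom (R := R) (M := L)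
    have := isNoetherian_moduleSocle_of_essential hf hess
    let := completionModuleExt 0 L hA
    let := completionModuleExt 0 J hA
    have : IsNoetherian (AdicCompletion (IsLocalRing.maximalIdeal R) R) (ExtModule R 0 A J) :=
      isNoetherian_ext_zero_of_injective J
    have : Mono (ModuleCat.ofHom f) := (ModuleCat.mono_iff_injective _).mpr hf
    exact isNoetherian_of_injective
      (completionExtPostcomp hA (Abelian.Ext.mk₀ (ModuleCat.ofHom f)) (add_zero 0))
      (Abelian.Ext.postcomp_mk₀_injective_of_mono _ (ModuleCat.ofHom f))
  | succ i ih =>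
    obtain ⟨J, hJ, f, hf, hess⟩ := exists_injective_essential_embedding R L
    have : Injective J := (Module.injective_iff_injective_object R J).mp hJ
    let L₁ : Type u := J ⧸ LinearMap.range f
    let S : ShortComplex (ModuleCat.{u} R) :=
      ShortComplex.mk (ModuleCat.ofHom f) (ModuleCat.ofHom (LinearMap.range f).mkQ)
        (ModuleCat.hom_ext (LinearMap.range_mkQ_comp f))
    have hS : S.ShortExact :=
      { exact := (ShortComplex.ShortExact.moduleCat_exact_iff_function_exact S).mpr
          (LinearMap.exact_map_mkQ_range f)
        mono_f := (ModuleCat.mono_iff_injective _).mpr hf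
        epi_g := (ModuleCat.epi_iff_surjective _).mpr (Submodule.mkQ_surjective _) }
    -- In degree 0 a map k → J lands in the socle of J, which lies in L by essentiality; in positive
    -- degree Ext into J vanishes.
    have hzero : ∀ y : Abelian.Ext (ModuleCat.of R (IsLocalRing.ResidueField R)) S.X₂ i,
        y.comp (Abelian.Ext.mk₀ S.g) (add_zero i) = 0 := by
      intro y
      cases i with
      | zero =>
        obtain ⟨φ, rfl⟩ := Abelian.Ext.addEquiv₀.symm.surjective y
        have : φ ≫ S.g = 0 := by
          ext x
          refine (Submodule.Quotient.mk_eq_zero _).mpr (moduleSocle_le_of_essential hess ?_)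
          refine mem_moduleSocle_of_forall fun a ha => ?_
          rw [← map_smul, Algebra.smul_def, IsLocalRing.ResidueField.algebraMap_eq,
            (IsLocalRing.residue_eq_zero_iff a).mpr ha, zero_mul, map_zero]
        simp [this]
      | succ i =>
        have : Injective S.X₂ := ‹Injective J›
        rw [Abelian.Ext.eq_zero_of_injective y, Abelian.Ext.zero_comp]
    let δ : ExtModule R i (IsLocalRing.ResidueField R) L₁ →ₗ[R]
        ExtModule R (i + 1) (IsLocalRing.ResidueField R) L :=
      { toFun x := x.comp hS.extClass rfl
        map_add' x y := Abelian.Ext.add_comp _ _ _ _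
        map_smul' r x := Abelian.Ext.smul_comp _ _ _ _ }
    have hδ : Function.Injective δ := by
      rw [injective_iff_map_eq_zero]
      intro x hx
      obtain ⟨y, rfl⟩ := Abelian.Ext.covariant_sequence_exact₃ _ hS x rfl hx
      exact hzero y
    have := ih L₁ (hL.of_injective hδ)
    let := completionModuleExt i L₁ hA
    let := completionModuleExt (i + 1) L hA
    refine isNoetherian_of_surjective
      (completionExtPostcomp hA (N := L₁) (N' := L) hS.extClass (rfl : i + 1 = i + 1))
      (LinearMap.range_eq_top.mpr fun x => ?_)
    have : Injective S.X₂ := ‹Injective J›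
    obtain ⟨z, hz⟩ := Abelian.Ext.covariant_sequence_exact₁ _ hS x
      (Abelian.Ext.eq_zero_of_injective _) rfl
    exact ⟨z, hz⟩

end ExtArtinian

/-! ### Tensoring with a torsion module: substitutes for Nakayama. -/

section TensorTorsion

open TensorProduct

variable {R : Type u} [CommRing R] {I : Ideal R} {A : Type u} [AddCommGroup A] [Module R A]
  {F : Type*} [AddCommGroup F] [Module R F]

theorem tmul_eq_zero_of_mem_smul_top {J : Ideal R} {a : A} (ha : ∀ r ∈ J, r • a = 0) {x : F}
    (hx : x ∈ (J • ⊤ : Submodule R F)) : a ⊗ₜ[R] x = 0 := by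
  refine Submodule.smul_induction_on (p := fun x => a ⊗ₜ[R] x = 0) hx (fun r hr y _ => ?_)
    (fun y z hy hz => ?_)
  · rw [← smul_tmul, ha r hr, zero_tmul]
  · rw [tmul_add, hy, hz, add_zero]

theorem sup_pow_smul_top_eq_top {Q : Submodule R F} (hQ : Q ⊔ I • ⊤ = ⊤) (n : ℕ) :
    Q ⊔ I ^ n • ⊤ = ⊤ := by
  induction n with
  | zero => simp
  | succ n ih =>
    have h : (I ^ n • ⊤ : Submodule R F) ≤ Q ⊔ I ^ (n + 1) • ⊤ :=
      calc (I ^ n • ⊤ : Submodule R F) = I ^ n • (Q ⊔ I • ⊤) := by rw [hQ]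
        _ = I ^ n • Q ⊔ I ^ n • I • ⊤ := Submodule.smul_sup _ _ _
        _ ≤ Q ⊔ I ^ (n + 1) • ⊤ :=
          sup_le_sup Submodule.smul_le_right (by rw [pow_succ, Submodule.mul_smul])
    exact eq_top_iff.mpr (ih.ge.trans (sup_le le_sup_left h))

/-- A submodule that generates `F` modulo `I` generates `A ⊗ F` for every `I`-torsion `A`. -/
theorem lTensor_subtype_surjective_of_isAdicTorsion (hA : IsAdicTorsion I A) {Q : Submodule R F}
    (hQ : Q ⊔ I • ⊤ = ⊤) : Function.Surjective (Q.subtype.lTensor A) := by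
  rw [← LinearMap.range_eq_top, eq_top_iff]
  rintro z -
  induction z using TensorProduct.induction_on with
  | zero => exact Submodule.zero_mem _
  | add y z hy hz => exact Submodule.add_mem _ hy hz
  | tmul a x =>
    -- Since I^n kills a, only the class of x modulo I^n matters, and `Q` generates F modulo every
    -- power of I.
    obtain ⟨n, hn⟩ := hA a
    obtain ⟨q, hq, w, hw, rfl⟩ := Submodule.mem_sup.mp
      ((sup_pow_smul_top_eq_top hQ n).ge (Submodule.mem_top (x := x)))
    rw [tmul_add, tmul_eq_zero_of_mem_smul_top hn hw, add_zero]
    exact ⟨a ⊗ₜ ⟨q, hq⟩, rfl⟩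

/-- An endomorphism of `F` that is the identity modulo `I` is injective on `A ⊗ F` for every
`I`-torsion `A`. -/
theorem lTensor_injective_of_sub_mem_smul_top (hA : IsAdicTorsion I A) (v : F →ₗ[R] F)
    (hv : ∀ x, x - v x ∈ (I • ⊤ : Submodule R F)) : Function.Injective (v.lTensor A) := by
  -- δ^n maps F into I^n F, so δ is locally nilpotent on A ⊗ F; but it fixes every element of the
  -- kernel of A ⊗ v.
  let δ : Module.End R F := LinearMap.id - v
  have hδ : ∀ (n : ℕ) (x : F), (δ ^ n) x ∈ (I ^ n • ⊤ : Submodule R F) := by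
    intro n
    induction n with
    | zero => simp
    | succ n ih =>
      intro x
      rw [pow_succ δ, Module.End.mul_apply]
      have hle : (I • ⊤ : Submodule R F) ≤ (I ^ (n + 1) • ⊤ : Submodule R F).comap (δ ^ n) := by
        refine Submodule.smul_le.mpr fun r hr y _ => ?_
        rw [Submodule.mem_comap, map_smul, pow_succ', Submodule.mul_smul]
        exact Submodule.smul_mem_smul hr (ih y)
      exact hle (hv x)
  have hnil : ∀ z : A ⊗[R] F, ∃ n, ∀ m ≥ n, (δ ^ m).lTensor A z = 0 := by
    intro z
    induction z using TensorProduct.induction_on with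
    | zero => exact ⟨0, fun m _ => map_zero _⟩
    | add y z hy hz =>
      obtain ⟨n, hn⟩ := hy
      obtain ⟨n', hn'⟩ := hz
      refine ⟨max n n', fun m hm => ?_⟩
      rw [map_add, hn m (le_of_max_le_left hm), hn' m (le_of_max_le_right hm), add_zero]
    | tmul a x =>
      obtain ⟨n, hn⟩ := hA a
      refine ⟨n, fun m hm => ?_⟩
      rw [LinearMap.lTensor_tmul]
      exact tmul_eq_zero_of_mem_smul_top (fun r hr => hn r (Ideal.pow_le_pow_right hm hr)) (hδ m x)
  rw [injective_iff_map_eq_zero]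
  intro z hz
  have hz' : δ.lTensor A z = z := by
    rw [LinearMap.lTensor_sub, LinearMap.sub_apply, hz, sub_zero, LinearMap.lTensor_id_apply]
  have hpow : ∀ n, (δ ^ n).lTensor A z = z := by
    intro n
    induction n with
    | zero => exact LinearMap.lTensor_id_apply _ _ _
    | succ n ih =>
      rw [pow_succ, Module.End.mul_eq_comp, LinearMap.lTensor_comp_apply, hz', ih]
  obtain ⟨n, hn⟩ := hnil z
  rw [← hpow n, hn n le_rfl]

end TensorTorsion

/-! ### From homology over the residue field to homology with artinian coefficients. -/

section ResidueTensor

open TensorProduct IsLocalRing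

variable {R : Type u} [CommRing R] [IsLocalRing R] {F : Type*} [AddCommGroup F] [Module R F]

theorem one_tmul_residueField_surjective (w : ResidueField R ⊗[R] F) :
    ∃ x : F, (1 : ResidueField R) ⊗ₜ[R] x = w := by
  induction w using TensorProduct.induction_on with
  | zero => exact ⟨0, tmul_zero _ _⟩
  | add y z hy hz =>
    obtain ⟨y, rfl⟩ := hy
    obtain ⟨z, rfl⟩ := hz
    exact ⟨y + z, tmul_add _ _ _⟩
  | tmul c x =>
    obtain ⟨c, rfl⟩ := residue_surjective c
    refine ⟨c • x, ?_⟩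
    rw [← smul_tmul, Algebra.smul_def, mul_one]
    rfl

theorem mem_smul_top_of_one_tmul_eq_zero {x : F} (h : (1 : ResidueField R) ⊗ₜ[R] x = 0) :
    x ∈ (maximalIdeal R • ⊤ : Submodule R F) := by
  have h' : quotTensorEquivQuotSMul F (maximalIdeal R) (1 ⊗ₜ[R] x) = 0 :=
    (LinearEquiv.map_eq_zero_iff _).mpr h
  rw [quotTensorEquivQuotSMul_mk_one_tmul] at h'
  exact (Submodule.Quotient.mk_eq_zero _).mp h'

end ResidueTensor

theorem Finsupp.mem_smul_top_of_forall_mem {R : Type*} [CommRing R] {ι : Type*} {I : Ideal R}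
    {x : ι →₀ R} (h : ∀ i, x i ∈ I) : x ∈ (I • ⊤ : Submodule R (ι →₀ R)) := by
  rw [← Finsupp.sum_single x]
  refine Submodule.sum_mem _ fun i _ => ?_
  rw [← mul_one (x i), ← smul_eq_mul, ← Finsupp.smul_single]
  exact Submodule.smul_mem_smul (h i) Submodule.mem_top

section TensorHomology

open TensorProduct IsLocalRing

variable {R : Type u} [CommRing R] [IsLocalRing R]
  {F₁ F₀ F₂ : Type u} [AddCommGroup F₁] [Module R F₁] [AddCommGroup F₀] [Module R F₀]
  [AddCommGroup F₂] [Module R F₂]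

/-- If the homology of `k ⊗ F₁ → k ⊗ F₀ → k ⊗ F₂` is spanned by `s` elements and `F₂` is projective,
then modulo the maximal ideal `F₀` is spanned by the boundaries, a free module of rank `s`, and a
free module `G` such that `G → F₂` is split injective modulo the maximal ideal. -/
theorem exists_free_generators_of_residueField_homology (d₁ : F₁ →ₗ[R] F₀) (d₀ : F₀ →ₗ[R] F₂)
    [Module.Projective R F₂] {s : ℕ} (b : Fin s → ResidueField R ⊗[R] F₀)
    (hb : ∀ z, d₀.lTensor (ResidueField R) z = 0 →
      ∃ (c : Fin s → R) (w : ResidueField R ⊗[R] F₁),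
        z = ∑ j, c j • b j + d₁.lTensor (ResidueField R) w) :
    ∃ (ι : Type u) (g : (ι →₀ R) →ₗ[R] F₀) (ν : (Fin s → R) →ₗ[R] F₀) (r : F₂ →ₗ[R] (ι →₀ R)),
      (LinearMap.range d₁ ⊔ LinearMap.range ν ⊔ LinearMap.range g) ⊔ maximalIdeal R • ⊤ = ⊤ ∧
      ∀ x, x - (r ∘ₗ d₀ ∘ₗ g) x ∈ (maximalIdeal R • ⊤ : Submodule R (ι →₀ R)) := by
  let k := ResidueField R
  -- Over the field k the cycles have a complement `C`, on which the differential is injective; a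
  -- basis of `C` lifts to F₀ and defines `g`.
  let D₀ : k ⊗[R] F₀ →ₗ[k] k ⊗[R] F₂ := d₀.baseChange k
  obtain ⟨C, hC⟩ := (LinearMap.ker D₀).exists_isCompl
  have : Module.Free k C := Module.Free.of_divisionRing (ResidueField R) C
  let ι := Module.Free.ChooseBasisIndex k C
  let c : Module.Basis ι k C := Module.Free.chooseBasis k C
  choose γ hγ using fun i => one_tmul_residueField_surjective (c i : k ⊗[R] F₀)
  choose y hy using fun j => one_tmul_residueField_surjective (b j)
  let g : (ι →₀ R) →ₗ[R] F₀ := Finsupp.linearCombination R γ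
  let ν : (Fin s → R) →ₗ[R] F₀ := Fintype.linearCombination R y
  have hinj : Function.Injective (D₀ ∘ₗ C.subtype ∘ₗ c.repr.symm.toLinearMap) := by
    rw [← LinearMap.ker_eq_bot, Submodule.eq_bot_iff]
    intro x hx
    have h0 : ((c.repr.symm x : C) : k ⊗[R] F₀) ∈ LinearMap.ker D₀ ⊓ C := ⟨hx, Subtype.prop _⟩
    rw [hC.inf_eq_bot, Submodule.mem_bot] at h0
    exact (LinearEquiv.map_eq_zero_iff c.repr.symm).mp (Subtype.ext h0)
  obtain ⟨p, hp⟩ := LinearMap.exists_leftInverse_of_injective _ (LinearMap.ker_eq_bot.mpr hinj)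
  let res : R →ₗ[R] k := Algebra.linearMap R k
  have hres : Function.Surjective res := residue_surjective
  let ρ : (ι →₀ R) →ₗ[R] (ι →₀ k) := Finsupp.mapRange.linearMap res
  -- Projectivity of F₂ lifts the k-linear left inverse `p` to an R-linear map.
  obtain ⟨r, hr⟩ := Module.projective_lifting_property ρ
    (p.restrictScalars R ∘ₗ TensorProduct.mk R k F₂ 1)
    (Finsupp.mapRange_surjective res (map_zero res) hres)
  refine ⟨ι, g, ν, r, ?_, fun x => ?_⟩
  · let Q := LinearMap.range d₁ ⊔ LinearMap.range ν ⊔ LinearMap.range g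
    -- The image of Q in k ⊗ F₀ is a k-subspace because R → k is onto; it contains both the cycles
    -- and `C`.
    let T : Submodule k (k ⊗[R] F₀) :=
      { carrier := {w | ∃ q ∈ Q, (1 : k) ⊗ₜ[R] q = w}
        add_mem' := by
          rintro _ _ ⟨q, hq, rfl⟩ ⟨q', hq', rfl⟩
          exact ⟨q + q', Q.add_mem hq hq', tmul_add _ _ _⟩
        zero_mem' := ⟨0, Q.zero_mem, tmul_zero _ _⟩
        smul_mem' := by
          rintro a _ ⟨q, hq, rfl⟩
          obtain ⟨a, rfl⟩ := residue_surjective a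
          exact ⟨a • q, Q.smul_mem a hq, by rw [tmul_smul]; rfl⟩ }
    have hTC : C ≤ T := by
      have : C = (Submodule.span k (Set.range c)).map C.subtype := by
        rw [c.span_eq, Submodule.map_top, Submodule.range_subtype]
      rw [this, Submodule.map_span, Submodule.span_le]
      rintro _ ⟨_, ⟨i, rfl⟩, rfl⟩
      refine ⟨γ i, Submodule.mem_sup_right ⟨Finsupp.single i 1, by simp [g]⟩, hγ i⟩
    have hTZ : LinearMap.ker D₀ ≤ T := by
      intro z hz
      obtain ⟨a, w, rfl⟩ := hb z hz
      obtain ⟨f, rfl⟩ := one_tmul_residueField_surjective w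
      refine ⟨ν a + d₁ f, Q.add_mem (Submodule.mem_sup_left (Submodule.mem_sup_right ⟨a, rfl⟩))
        (Submodule.mem_sup_left (Submodule.mem_sup_left ⟨f, rfl⟩)), ?_⟩
      rw [tmul_add, LinearMap.lTensor_tmul, Fintype.linearCombination_apply, tmul_sum]
      congr 1
      exact Finset.sum_congr rfl fun j _ => by rw [tmul_smul, hy]
    have hT : T = ⊤ := eq_top_iff.mpr (hC.sup_eq_top.ge.trans (sup_le hTZ hTC))
    rw [eq_top_iff]
    rintro x -
    obtain ⟨q, hq, hqx⟩ : (1 : k) ⊗ₜ[R] x ∈ T := hT ▸ Submodule.mem_top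
    refine Submodule.mem_sup.mpr ⟨q, hq, x - q, mem_smul_top_of_one_tmul_eq_zero ?_, by abel⟩
    rw [tmul_sub, hqx, sub_self]
  · refine Finsupp.mem_smul_top_of_forall_mem fun i => ?_
    have key : ρ ∘ₗ (r ∘ₗ d₀ ∘ₗ g) = ρ := by
      refine Finsupp.lhom_ext' fun j => LinearMap.ext_ring ?_
      have h1 : g (Finsupp.single j 1) = γ j := by simp [g]
      have h2 : ρ (r (d₀ (γ j))) = p ((1 : k) ⊗ₜ[R] d₀ (γ j)) := LinearMap.congr_fun hr _
      have h3 : (1 : k) ⊗ₜ[R] d₀ (γ j) = D₀ (c j) := by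
        rw [← hγ j]
        rfl
      have h4 : p (D₀ (c j)) = Finsupp.single j 1 := by
        have := LinearMap.congr_fun hp (Finsupp.single j 1)
        simpa using this
      change ρ (r (d₀ (g (Finsupp.single j 1)))) = ρ (Finsupp.single j 1)
      rw [h1, h2, h3, h4]
      simp [ρ, res]
    have h5 : res ((x - (r ∘ₗ d₀ ∘ₗ g) x) i) = 0 := by
      have : ρ (x - (r ∘ₗ d₀ ∘ₗ g) x) = 0 := by
        rw [map_sub, sub_eq_zero]
        exact (LinearMap.congr_fun key x).symm
      exact DFunLike.congr_fun this i
    exact (residue_eq_zero_iff _).mp h5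

/-- If the homology of `k ⊗ F₁ → k ⊗ F₀ → k ⊗ F₂` is finitely generated and `F₂` is projective, then
the homology of `A ⊗ F₁ → A ⊗ F₀ → A ⊗ F₂` is artinian for every artinian torsion module `A`. -/
theorem isArtinian_of_residueField_homology {A : Type u} [AddCommGroup A] [Module R A]
    [IsArtinian R A] (hA : IsAdicTorsion (maximalIdeal R) A)
    {d₁ : F₁ →ₗ[R] F₀} {d₀ : F₀ →ₗ[R] F₂} (hd : d₀ ∘ₗ d₁ = 0)
    [Module.Projective R F₂] {s : ℕ} (b : Fin s → ResidueField R ⊗[R] F₀)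
    (hb : ∀ z, d₀.lTensor (ResidueField R) z = 0 →
      ∃ (c : Fin s → R) (w : ResidueField R ⊗[R] F₁),
        z = ∑ j, c j • b j + d₁.lTensor (ResidueField R) w)
    {H : Type*} [AddCommGroup H] [Module R H] (π : LinearMap.ker (d₀.lTensor A) →ₗ[R] H)
    (hπ : Function.Surjective π) (hπ0 : ∀ z w, d₁.lTensor A w = z.1 → π z = 0) :
    IsArtinian R H := by
  obtain ⟨ι, g, ν, r, hgen, hr⟩ := exists_free_generators_of_residueField_homology d₁ d₀ b hb
  have hdA : ∀ w, d₀.lTensor A (d₁.lTensor A w) = 0 := fun w => by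
    rw [← LinearMap.lTensor_comp_apply, hd, LinearMap.lTensor_zero, LinearMap.zero_apply]
  have hspan : ∀ z : A ⊗[R] F₀, ∃ w y x,
      z = d₁.lTensor A w + (ν.lTensor A y + g.lTensor A x) := by
    intro z
    obtain ⟨z, rfl⟩ := lTensor_subtype_surjective_of_isAdicTorsion hA hgen z
    induction z using TensorProduct.induction_on with
    | zero => exact ⟨0, 0, 0, by simp⟩
    | add z z' hz hz' =>
      obtain ⟨w, y, x, h⟩ := hz
      obtain ⟨w', y', x', h'⟩ := hz'
      refine ⟨w + w', y + y', x + x', ?_⟩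
      simp only [map_add, h, h']
      abel
    | tmul a q =>
      obtain ⟨q, hq⟩ := q
      obtain ⟨_, hq1, _, ⟨x, rfl⟩, rfl⟩ := Submodule.mem_sup.mp hq
      obtain ⟨_, ⟨w, rfl⟩, _, ⟨y, rfl⟩, rfl⟩ := Submodule.mem_sup.mp hq1
      refine ⟨a ⊗ₜ w, a ⊗ₜ y, a ⊗ₜ x, ?_⟩
      simp only [LinearMap.lTensor_tmul, Submodule.subtype_apply, tmul_add, add_assoc]
  let σ : (A ⊗[R] (Fin s → R)) × (A ⊗[R] (ι →₀ R)) →ₗ[R] A ⊗[R] F₀ :=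
    (ν.lTensor A).coprod (g.lTensor A)
  let T := LinearMap.ker (d₀.lTensor A ∘ₗ σ)
  have : IsArtinian R (A ⊗[R] (Fin s → R)) :=
    (TensorProduct.piScalarRight R R A (Fin s)).isArtinian_iff.mpr inferInstance
  -- If y = 0 then A ⊗ (r d₀ g) kills x, and this map is injective, so x = 0: projection to A^s is
  -- injective on `T`.
  have hT : IsArtinian R T := by
    refine isArtinian_of_injective (LinearMap.fst R _ _ ∘ₗ T.subtype) ?_
    rw [injective_iff_map_eq_zero]
    rintro ⟨⟨y, x⟩, hyx⟩ (rfl : y = 0)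
    have h0 : d₀.lTensor A (g.lTensor A x) = 0 := by simpa [T, σ] using hyx
    have h1 : (r ∘ₗ d₀ ∘ₗ g).lTensor A x = 0 := by
      rw [LinearMap.lTensor_comp_apply, LinearMap.lTensor_comp_apply, h0, map_zero]
    have h2 : x = 0 := lTensor_injective_of_sub_mem_smul_top hA _ hr (h1.trans (map_zero _).symm)
    subst h2
    rfl
  let τ : T →ₗ[R] LinearMap.ker (d₀.lTensor A) :=
    (σ ∘ₗ T.subtype).codRestrict _ fun x => x.2
  -- Every cycle differs by a boundary from some σ(y, x), which is then itself a cycle.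
  refine isArtinian_of_surjective T (π ∘ₗ τ) fun e => ?_
  obtain ⟨⟨z, hz⟩, rfl⟩ := hπ e
  obtain ⟨w, y, x, rfl⟩ := hspan z
  have hyx : d₀.lTensor A (σ (y, x)) = 0 := by
    rw [LinearMap.mem_ker, map_add, hdA, zero_add] at hz
    exact hz
  refine ⟨⟨(y, x), hyx⟩, ?_⟩
  rw [LinearMap.comp_apply, ← sub_eq_zero, ← map_sub]
  refine hπ0 _ (-w) ?_
  rw [map_neg]
  change -(d₁.lTensor A w) = (ν.lTensor A y + g.lTensor A x) -
    (d₁.lTensor A w + (ν.lTensor A y + g.lTensor A x))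
  abel

end TensorHomology

/-! ### Tor through a projective resolution. -/

section Tor

/-- The homology of a short complex of modules is the quotient of the kernel by the image. -/
theorem exists_surjective_ker_homology {R : Type u} [Ring R] (S : ShortComplex (ModuleCat.{u} R)) :
    ∃ π : LinearMap.ker S.g.hom →ₗ[R] S.homology, Function.Surjective π ∧
      ∀ z, π z = 0 ↔ ∃ w, S.f.hom w = z.1 := by
  let e := S.moduleCatHomologyIso.toLinearEquiv
  refine ⟨e.symm.toLinearMap ∘ₗ (LinearMap.range S.moduleCatToCycles).mkQ,
    e.symm.surjective.comp (Submodule.mkQ_surjective _), fun z => ?_⟩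
  refine (LinearEquiv.map_eq_zero_iff e.symm).trans ?_
  refine (Submodule.Quotient.mk_eq_zero _).trans ?_
  exact ⟨fun ⟨w, hw⟩ => ⟨w, congrArg Subtype.val hw⟩, fun ⟨w, hw⟩ => ⟨w, Subtype.ext hw⟩⟩

variable {R : Type u} [CommRing R]

/-- `Tor_i(M, N)` is the homology of `M ⊗ P` for a projective resolution `P` of `N`. -/
theorem exists_surjective_ker_torModule (i : ℕ) (M N : Type u) [AddCommGroup M] [Module R M]
    [AddCommGroup N] [Module R N] (P : ProjectiveResolution (ModuleCat.of R N)) :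
    ∃ π : LinearMap.ker ((P.complex.sc i).g.hom.lTensor M) →ₗ[R] TorModule R i M N,
      Function.Surjective π ∧ ∀ z, π z = 0 ↔ ∃ w, (P.complex.sc i).f.hom.lTensor M w = z.1 := by
  let F := (MonoidalCategory.tensoringLeft (ModuleCat.{u} R)).obj (ModuleCat.of R M)
  obtain ⟨π, hπ, h0⟩ := exists_surjective_ker_homology
    (((F.mapHomologicalComplex _).obj P.complex).sc i)
  let e := (P.isoLeftDerivedObj F i).toLinearEquiv
  refine ⟨e.symm.toLinearMap ∘ₗ π, e.symm.surjective.comp hπ, fun z => ?_⟩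
  exact (LinearEquiv.map_eq_zero_iff e.symm).trans (h0 z)

/-- Lifts of generators of the image of κ. With κ the map from cycles to homology, they are the
finitely many cycles needed over k. -/
theorem exists_generators_modulo_ker {K H : Type*} [AddCommGroup K] [Module R K] [AddCommGroup H]
    [Module R H] [IsNoetherian R H] (κ : K →ₗ[R] H) :
    ∃ (s : ℕ) (b : Fin s → K), ∀ z, ∃ a : Fin s → R, κ (z - ∑ j, a j • b j) = 0 := by
  obtain ⟨s, c, hc⟩ := Submodule.fg_iff_exists_fin_generating_family.mp
    (IsNoetherian.noetherian (LinearMap.range κ))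
  choose b hb using fun j => (hc ▸ Submodule.subset_span ⟨j, rfl⟩ : c j ∈ LinearMap.range κ)
  refine ⟨s, b, fun z => ?_⟩
  obtain ⟨a, ha⟩ : κ z ∈ LinearMap.range (Fintype.linearCombination R c) := by
    rw [Fintype.range_linearCombination, hc]
    exact ⟨z, rfl⟩
  refine ⟨a, ?_⟩
  rw [map_sub, ← ha, map_sum, Fintype.linearCombination_apply, sub_eq_zero]
  exact Finset.sum_congr rfl fun j _ => by rw [map_smul, hb]

theorem isArtinian_tor [IsLocalRing R] [IsNoetherianRing R] {A : Type u} [AddCommGroup A]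
    [Module R A] [IsArtinian R A] (i : ℕ) (L : Type u) [AddCommGroup L] [Module R L]
    (hL : IsFiniteLength R (TorModule R i (IsLocalRing.ResidueField R) L)) :
    IsArtinian R (TorModule R i A L) := by
  let P := projectiveResolution (ModuleCat.of R L)
  -- For i = 0 the third term is the degree 0 module again, with zero differential, so no case split
  -- is needed.
  have hproj : Module.Projective R (P.complex.sc i).X₃ :=
    (IsProjective.iff_projective _).mpr (P.projective _)
  obtain ⟨π, hπ, hπ0⟩ := exists_surjective_ker_torModule i A L P
  obtain ⟨κ, -, hκ0⟩ := exists_surjective_ker_torModule i (IsLocalRing.ResidueField R) L P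
  have := (isFiniteLength_iff_isNoetherian_isArtinian.mp hL).1
  obtain ⟨s, b, hb⟩ := exists_generators_modulo_ker
    (K := LinearMap.ker ((P.complex.sc i).g.hom.lTensor (IsLocalRing.ResidueField R))) κ
  refine isArtinian_of_residueField_homology (isAdicTorsion_of_isArtinian R A)
    (d₁ := (P.complex.sc i).f.hom) (d₀ := (P.complex.sc i).g.hom)
    (by rw [← ModuleCat.hom_comp, (P.complex.sc i).zero, ModuleCat.hom_zero])
    (fun j => (b j).1) (fun z hz => ?_) π hπ (fun z w h => (hπ0 z).mpr ⟨w, h⟩)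
  rw [← LinearMap.mem_ker] at hz
  obtain ⟨a, ha⟩ := hb ⟨z, hz⟩
  obtain ⟨w, hw⟩ := (hκ0 _).mp ha
  refine ⟨a, w, ?_⟩
  rw [hw]
  simp

end Tor

theorem theoremB (R : Type u) [CommRing R] [IsLocalRing R] [IsNoetherianRing R]
    (A L L' : Type u) [AddCommGroup A] [Module R A] [AddCommGroup L] [Module R L]
    [AddCommGroup L'] [Module R L'] [IsArtinian R A] (i : ℕ) :
    (bassNumber R i L < ⊤ →
      letI : Module (AdicCompletion (IsLocalRing.maximalIdeal R) R) (ExtModule R i A L) :=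
        completionModuleExt i L (isAdicTorsion_of_isArtinian R A)
      IsNoetherian (AdicCompletion (IsLocalRing.maximalIdeal R) R) (ExtModule R i A L)) ∧
    (bettiNumber R i L' < ⊤ → IsArtinian R (TorModule R i A L')) := by
  exact ⟨fun h => isNoetherian_ext i L (Module.length_ne_top_iff.mp h.ne),
    fun h => isArtinian_tor i L' (Module.length_ne_top_iff.mp h.ne)⟩
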